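/- Let $\Omega\subset\mathbb{R}^2$ be open. A minimal graph supported on $\Omega$ is a pair $(\Omega,u)$, where $u$ is a real function, continuous on $\overline{\Omega}$ and of class $C^2$ in $\Omega$, such that $$\operatorname{div}\left(\frac{\nabla u}{\sqrt{1+|\nabla u|^2}}\right)=0 \text{ in } \Omega,\qquad u=0 \text{ on } \partial\Omega,\qquad u\ge 0 \text{ in } \Omega .$$ **Theorem 3.1.** Let $\Omega_1,\dots,\Omega_k\subset\mathbb{R}^2$ be pairwise disjoint open sets and, for each $i$, let $(\Omega_i,u_i)$ be a minimal graph supported on $\Omega_i$ with $u_i$ not identically zero on $\Omega_i$. If the gradients are bounded by a constant $c$, i.e. $|\nabla u_i|\le c$ on $\Omega_i$ for every $i$, then $$k\le 2\sqrt{1+c^2}.$$ -/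

import Mathlib

/-- The Euclidean plane `ℝ²`. -/
abbrev Plane : Type := EuclideanSpace ℝ (Fin 2)

/-- The divergence `∂₁F₁ + ∂₂F₂` of a planar vector field. -/
noncomputable def planeDiv (F : Plane → Plane) (x : Plane) : ℝ :=
  ∑ i : Fin 2, (fderiv ℝ F x (EuclideanSpace.single i 1)) i

/-- `u` is a classical (`C²`) solution on the open set `Ω` of the minimal surface equation
`div (∇u / √(1 + |∇u|²)) = 0`, so that `{(x, u x) | x ∈ Ω}` is a minimal graph in `ℝ³`.
Only the values of `u` on `Ω` matter, since `Ω` is open. -/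
structure IsMinimalGraph (Ω : Set Plane) (u : Plane → ℝ) : Prop where
  isOpen : IsOpen Ω
  contDiffOn : ContDiffOn ℝ 2 u Ω
  div_eq_zero : ∀ x ∈ Ω,
    planeDiv (fun y => (Real.sqrt (1 + ‖gradient u y‖ ^ 2))⁻¹ • gradient u y) x = 0

/-- A minimal graph supported on `Ω`: `u` extends continuously to the boundary of `Ω` with
boundary values zero, and `u ≥ 0`. -/
structure IsSupportedMinimalGraph (Ω : Set Plane) (u : Plane → ℝ) : Prop
    extends IsMinimalGraph Ω u where
  continuousOn_closure : ContinuousOn u (closure Ω)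
  boundary_eq_zero : ∀ x ∈ frontier Ω, u x = 0
  nonneg : ∀ x ∈ Ω, 0 ≤ u x

/-! Each `u i` is cut off just above the level zero and extended by zero. The result `f i` is a
nonnegative Lipschitz subsolution on the whole plane of `div (a ∇f) = 0`, where `a = (1 +
|∇u|²)^(-1/2)` lies between `l = (1 + c²)^(-1/2)` and `1`, and the `f i` have disjoint supports.

Let `J i r` be the flux of `f a ∇f` through the circle of radius `r`. Its derivative dominates the
integral of `a |∇f|²` over that circle. If `f i` is nonzero on a set of angles of measure `θ i`,
Wirtinger's inequality (`wirtinger_of_periodic`) bounds the tangential energy from below, whence `2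
(π √l / θ i) J i ≤ r (J i)'` (`energyFlux_le_energyFluxDeriv`). The angles `θ i` add up to at most
`2π`, so Cauchy–Schwarz makes the logarithmic derivative of `∏ J i` at least `k² √l / r`. The
product thus grows at least like `r ^ (k² √l)`. Bounded gradients give `J i = O(r²)`, so it grows at
most like `r ^ (2k)`, and `k √l ≤ 2` follows (`card_mul_sqrt_le_two`). -/

open Real Set Filter Topology MeasureTheory

/-- Differentiation under the integral sign over a compact interval. -/
theorem hasDerivAt_intervalIntegral_of_continuous {F F' : ℝ → ℝ → ℝ} {a b : ℝ}
    (hF : ∀ r φ, HasDerivAt (fun s => F s φ) (F' r φ) r)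
    (hFc : ∀ r, Continuous (F r)) (hF'c : Continuous (Function.uncurry F')) (r : ℝ) :
    HasDerivAt (fun s => ∫ φ in a..b, F s φ) (∫ φ in a..b, F' r φ) r := by
  obtain ⟨C, hC⟩ := ((isCompact_closedBall r 1).prod isCompact_uIcc).exists_bound_of_continuousOn
    (s := Metric.closedBall r 1 ×ˢ uIcc a b) hF'c.continuousOn
  refine (intervalIntegral.hasDerivAt_integral_of_dominated_loc_of_deriv_le (bound := fun _ => C)
    (Metric.closedBall_mem_nhds r one_pos) (Eventually.of_forall fun s => ?_)
    ((hFc r).intervalIntegrable _ _) ?_ ?_ (by simp) ?_).2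
  · exact (hFc s).aestronglyMeasurable
  · exact (hF'c.comp (Continuous.prodMk_right r)).aestronglyMeasurable
  · refine Eventually.of_forall fun φ hφ s hs => hC (s, φ) ⟨hs, uIoc_subset_uIcc hφ⟩
  · exact Eventually.of_forall fun φ _ s _ => hF s φ

/-- A product is differentiable at a zero of the differentiable factor as soon as the other factor
is continuous there. -/
theorem HasDerivAt.continuousAt_mul_of_eq_zero {f h : ℝ → ℝ} {f' x : ℝ} (hf : HasDerivAt f f' x)
    (hh : ContinuousAt h x) (hx : f x = 0) : HasDerivAt (fun y => h y * f y) (h x * f') x := by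
  rw [hasDerivAt_iff_tendsto_slope] at hf ⊢
  refine ((hh.tendsto.mono_left nhdsWithin_le_nhds).mul hf).congr fun y => ?_
  simp only [slope_def_field, hx]
  ring

/-! ### Wirtinger's inequality with the measure of the support -/

/-- The indicator function of `{f ≠ 0}`. -/
noncomputable def supportIndicator (f : ℝ → ℝ) : ℝ → ℝ := (Function.support f).indicator 1

theorem supportIndicator_of_ne {f : ℝ → ℝ} {x : ℝ} (h : f x ≠ 0) : supportIndicator f x = 1 := by
  simp [supportIndicator, h]

theorem supportIndicator_of_eq {f : ℝ → ℝ} {x : ℝ} (h : f x = 0) : supportIndicator f x = 0 := by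
  simp [supportIndicator, h]

theorem supportIndicator_nonneg (f : ℝ → ℝ) (x : ℝ) : 0 ≤ supportIndicator f x :=
  indicator_nonneg (fun _ _ => zero_le_one) x

theorem supportIndicator_le_one (f : ℝ → ℝ) (x : ℝ) : supportIndicator f x ≤ 1 := by
  by_cases h : f x = 0
  · simp [supportIndicator_of_eq h]
  · simp [supportIndicator_of_ne h]

theorem measurable_supportIndicator {f : ℝ → ℝ} (hf : Continuous f) :
    Measurable (supportIndicator f) :=
  measurable_one.indicator hf.isOpen_support.measurableSet

theorem intervalIntegrable_supportIndicator {f : ℝ → ℝ} (hf : Continuous f) (a b : ℝ) :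
    IntervalIntegrable (supportIndicator f) volume a b := by
  refine (intervalIntegrable_const (c := (1 : ℝ))).mono_fun
    (measurable_supportIndicator hf).aestronglyMeasurable (Eventually.of_forall fun x => ?_)
  simpa [abs_of_nonneg (supportIndicator_nonneg f x)] using supportIndicator_le_one f x

theorem continuous_primitive_supportIndicator {f : ℝ → ℝ} (hf : Continuous f) (a : ℝ) :
    Continuous fun x => ∫ t in a..x, supportIndicator f t :=
  intervalIntegral.continuous_primitive (intervalIntegrable_supportIndicator hf) a

theorem hasDerivAt_primitive_supportIndicator {f : ℝ → ℝ} (hf : Continuous f) (a : ℝ) {x : ℝ}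
    (hx : f x ≠ 0) : HasDerivAt (fun x => ∫ t in a..x, supportIndicator f t) 1 x := by
  have hev : supportIndicator f =ᶠ[𝓝 x] fun _ => 1 :=
    (hf.continuousAt.eventually_ne hx).mono fun y hy => supportIndicator_of_ne hy
  rw [← supportIndicator_of_ne hx]
  exact intervalIntegral.integral_hasDerivAt_right (intervalIntegrable_supportIndicator hf _ _)
    (measurable_supportIndicator hf).stronglyMeasurable.stronglyMeasurableAtFilter
    (continuousAt_const.congr hev.symm)

/-- A Riccati argument in which the variable is replaced by the measure of the part of the support
to its left. On `{f ≠ 0}` one has `M' = κ`, so `f'² + (κ tan M f²)' = κ² f² + (f' + κ tan M f)²`;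
the boundary terms vanish on integration. Centring `M` at `θ / 2` and requiring `κ θ < π` keep `M`
inside `(-π/2, π/2)`. -/
theorem wirtinger_of_lt {f f' : ℝ → ℝ} {a b κ : ℝ} (hab : a ≤ b)
    (hf : ∀ x, HasDerivAt f (f' x) x) (hf' : Continuous f') (ha : f a = 0) (hb : f b = 0)
    (hκ : 0 ≤ κ) (hκθ : κ * (∫ t in a..b, supportIndicator f t) < π) :
    κ ^ 2 * ∫ x in a..b, f x ^ 2 ≤ ∫ x in a..b, f' x ^ 2 := by
  have hfc : Continuous f := continuous_iff_continuousAt.2 fun x => (hf x).continuousAt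
  set θ := ∫ t in a..b, supportIndicator f t with hθ
  set M : ℝ → ℝ := fun x => κ * ((∫ t in a..x, supportIndicator f t) - θ / 2) with hM
  have hMc : Continuous M :=
    continuous_const.mul ((continuous_primitive_supportIndicator hfc a).sub continuous_const)
  have hcos : ∀ x ∈ Icc a b, cos (M x) ≠ 0 := fun x hx => by
    have h1 : 0 ≤ ∫ t in a..x, supportIndicator f t :=
      intervalIntegral.integral_nonneg hx.1 fun t _ => supportIndicator_nonneg f t
    have h2 : 0 ≤ ∫ t in x..b, supportIndicator f t :=
      intervalIntegral.integral_nonneg hx.2 fun t _ => supportIndicator_nonneg f t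
    have h3 : (∫ t in a..x, supportIndicator f t) + ∫ t in x..b, supportIndicator f t = θ :=
      intervalIntegral.integral_add_adjacent_intervals
        (intervalIntegrable_supportIndicator hfc _ _) (intervalIntegrable_supportIndicator hfc _ _)
    have h4 : κ * (∫ t in a..x, supportIndicator f t) ≤ κ * θ :=
      mul_le_mul_of_nonneg_left (by linarith) hκ
    have h5 := mul_nonneg hκ h1
    refine (cos_pos_of_mem_Ioo ⟨?_, ?_⟩).ne' <;> simp only [hM] <;> linarith
  have htc : ∀ x ∈ Icc a b, ContinuousAt (fun y => tan (M y)) x := fun x hx =>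
    ContinuousAt.comp (f := M) (g := tan) (continuousAt_tan.2 (hcos x hx)) hMc.continuousAt
  have hderiv : ∀ x ∈ uIcc a b, HasDerivAt (fun y => κ * tan (M y) * f y ^ 2)
      (κ ^ 2 * (1 + tan (M x) ^ 2) * f x ^ 2 + 2 * κ * tan (M x) * f x * f' x) x := by
    intro x hx
    rw [uIcc_of_le hab] at hx
    -- At a zero of `f` the function `M` may fail to be differentiable, but `tan M` is continuous
    -- and the factor `f²` still gives the product derivative zero.
    by_cases h0 : f x = 0
    · have h := HasDerivAt.continuousAt_mul_of_eq_zero (h := fun y => κ * tan (M y) * f y) (hf x)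
        ((continuousAt_const.mul (htc x hx)).mul hfc.continuousAt) h0
      simp only [h0, mul_zero, zero_mul] at h
      convert h using 1
      · ext y; ring
      · simp [h0]
    · have hm : HasDerivAt M (κ * 1) x :=
        ((hasDerivAt_primitive_supportIndicator hfc a h0).sub_const _).const_mul κ
      have ht := (hasDerivAt_tan (hcos x hx)).comp x hm
      refine ((ht.const_mul κ).mul ((hf x).pow 2)).congr_deriv ?_
      have : 1 / cos (M x) ^ 2 = 1 + tan (M x) ^ 2 := by
        rw [← inv_one_add_tan_sq (hcos x hx)]; simp
      rw [this]
      simp only [Function.comp_apply, Pi.pow_apply]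
      push_cast
      ring
  have hi : IntervalIntegrable (fun x => κ ^ 2 * (1 + tan (M x) ^ 2) * f x ^ 2
      + 2 * κ * tan (M x) * f x * f' x) volume a b := by
    refine ContinuousOn.intervalIntegrable fun x hx => ContinuousAt.continuousWithinAt ?_
    rw [uIcc_of_le hab] at hx
    have := htc x hx
    have := hfc.continuousAt (x := x)
    have := hf'.continuousAt (x := x)
    fun_prop
  have hzero := intervalIntegral.integral_eq_sub_of_hasDerivAt hderiv hi
  simp only [ha, hb] at hzero
  have hi1 : IntervalIntegrable (fun x => f' x ^ 2) volume a b :=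
    (hf'.pow 2).intervalIntegrable _ _
  have hi2 : IntervalIntegrable (fun x => κ ^ 2 * f x ^ 2) volume a b :=
    (continuous_const.mul (hfc.pow 2)).intervalIntegrable _ _
  have hmono := intervalIntegral.integral_mono_on hab hi2 (hi1.add hi) fun x _ => by
    nlinarith [sq_nonneg (f' x + κ * tan (M x) * f x)]
  rw [intervalIntegral.integral_add hi1 hi, hzero, intervalIntegral.integral_const_mul] at hmono
  linarith

/-- Wirtinger's inequality for a function vanishing at the end points of an interval, with the
constant determined by the measure of the set where the function does not vanish. -/
theorem wirtinger {f f' : ℝ → ℝ} {a b : ℝ} (hab : a ≤ b)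
    (hf : ∀ x, HasDerivAt f (f' x) x) (hf' : Continuous f') (ha : f a = 0) (hb : f b = 0)
    (hθ : 0 < ∫ t in a..b, supportIndicator f t) :
    (π / ∫ t in a..b, supportIndicator f t) ^ 2 * ∫ x in a..b, f x ^ 2
      ≤ ∫ x in a..b, f' x ^ 2 := by
  set θ := ∫ t in a..b, supportIndicator f t
  have hcont : Tendsto (fun κ : ℝ => κ ^ 2 * ∫ x in a..b, f x ^ 2) (𝓝[<] (π / θ))
      (𝓝 ((π / θ) ^ 2 * ∫ x in a..b, f x ^ 2)) :=
    ((continuous_pow 2).mul continuous_const).continuousWithinAt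
  refine le_of_tendsto hcont ?_
  filter_upwards [Ioo_mem_nhdsLT (div_pos pi_pos hθ)] with κ hκ
  exact wirtinger_of_lt hab hf hf' ha hb hκ.1.le ((lt_div_iff₀ hθ).1 hκ.2)

theorem integral_supportIndicator_pos {f : ℝ → ℝ} {a b x : ℝ} (hf : Continuous f) (hab : a < b)
    (hx : x ∈ Icc a b) (h : f x ≠ 0) : 0 < ∫ t in a..b, supportIndicator f t := by
  obtain ⟨C, hC⟩ := isCompact_Icc.exists_bound_of_continuousOn (s := Icc a b)
    (hf.pow 2).continuousOn
  have hpos : 0 < ∫ t in a..b, f t ^ 2 :=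
    intervalIntegral.integral_pos hab (hf.pow 2).continuousOn (fun t _ => sq_nonneg _)
      ⟨x, hx, by positivity⟩
  have hle : ∫ t in a..b, f t ^ 2 ≤ ∫ t in a..b, C * supportIndicator f t := by
    refine intervalIntegral.integral_mono_on hab.le ((hf.pow 2).intervalIntegrable _ _)
      ((intervalIntegrable_supportIndicator hf _ _).const_mul C) fun t ht => ?_
    by_cases h0 : f t = 0
    · simp [h0, supportIndicator_of_eq h0]
    · simpa [supportIndicator_of_ne h0] using hC t ht
  rw [intervalIntegral.integral_const_mul] at hle
  have hCn : 0 ≤ C := (norm_nonneg _).trans (hC x hx)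
  exact pos_of_mul_pos_right (hpos.trans_le hle) hCn

/-- Wirtinger's inequality on the circle for a function with a zero. -/
theorem wirtinger_of_periodic {f f' : ℝ → ℝ} {T x₀ x₁ : ℝ} (hT : 0 < T)
    (hf : ∀ x, HasDerivAt f (f' x) x) (hf' : Continuous f') (hper : f.Periodic T)
    (hper' : f'.Periodic T) (h0 : f x₀ = 0) (h1 : f x₁ ≠ 0) :
    0 < (∫ t in 0..T, supportIndicator f t) ∧
    (π / ∫ t in 0..T, supportIndicator f t) ^ 2 * ∫ x in 0..T, f x ^ 2
      ≤ ∫ x in 0..T, f' x ^ 2 := by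
  have hfc : Continuous f := continuous_iff_continuousAt.2 fun x => (hf x).continuousAt
  have e : ∀ {g : ℝ → ℝ}, g.Periodic T → ∫ t in 0..T, g t = ∫ t in x₀..x₀ + T, g t := fun hg => by
    simpa using hg.intervalIntegral_add_eq 0 x₀
  have hχ : (supportIndicator f).Periodic T := fun x => by
    simp only [supportIndicator, indicator, Function.mem_support, hper x, Pi.one_apply]
  rw [e hχ, e (g := fun x => f x ^ 2) fun x => by simp only [hper x],
    e (g := fun x => f' x ^ 2) fun x => by simp only [hper' x]]
  obtain ⟨y, hy, hxy⟩ := hper.exists_mem_Ico hT x₁ x₀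
  have hpos := integral_supportIndicator_pos hfc (b := x₀ + T) (by linarith)
    (Ico_subset_Icc_self hy) (hxy ▸ h1)
  exact ⟨hpos, wirtinger (by linarith) hf hf' h0 (by rw [hper, h0]) hpos⟩

/-! ### The divergence theorem on disks, in polar coordinates -/

/-- The point of the unit circle with polar angle `φ`. -/
noncomputable def unitVec (φ : ℝ) : Plane := !₂[cos φ, sin φ]

/-- The derivative of `unitVec`. -/
noncomputable def unitTangent (φ : ℝ) : Plane := !₂[-sin φ, cos φ]

theorem hasDerivAt_unitVec (φ : ℝ) : HasDerivAt unitVec (unitTangent φ) φ := by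
  rw [← hasDerivWithinAt_univ, hasDerivWithinAt_iff_hasFDerivWithinAt,
    hasFDerivWithinAt_euclidean]
  intro i
  rw [hasFDerivWithinAt_univ]
  fin_cases i
  · exact (hasDerivAt_cos φ).hasFDerivAt.congr_fderiv (by ext; simp [unitTangent])
  · exact (hasDerivAt_sin φ).hasFDerivAt.congr_fderiv (by ext; simp [unitTangent])

theorem hasDerivAt_unitTangent (φ : ℝ) : HasDerivAt unitTangent (-unitVec φ) φ := by
  rw [← hasDerivWithinAt_univ, hasDerivWithinAt_iff_hasFDerivWithinAt,
    hasFDerivWithinAt_euclidean]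
  intro i
  rw [hasFDerivWithinAt_univ]
  fin_cases i
  · exact (hasDerivAt_sin φ).neg.hasFDerivAt.congr_fderiv (by ext; simp [unitVec])
  · exact (hasDerivAt_cos φ).hasFDerivAt.congr_fderiv (by ext; simp [unitVec])

theorem continuous_unitVec : Continuous unitVec :=
  continuous_iff_continuousAt.2 fun x => (hasDerivAt_unitVec x).continuousAt

theorem continuous_unitTangent : Continuous unitTangent :=
  continuous_iff_continuousAt.2 fun x => (hasDerivAt_unitTangent x).continuousAt

theorem unitVec_periodic : unitVec.Periodic (2 * π) := fun x => by simp [unitVec]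

theorem unitTangent_periodic : unitTangent.Periodic (2 * π) := fun x => by simp [unitTangent]

theorem norm_unitVec (φ : ℝ) : ‖unitVec φ‖ = 1 := by
  simp [unitVec, EuclideanSpace.norm_eq, Fin.sum_univ_two]

theorem exists_eq_smul_unitVec (x : Plane) : ∃ φ : ℝ, x = ‖x‖ • unitVec φ := by
  refine ⟨Complex.arg ⟨x 0, x 1⟩, ?_⟩
  have hn : ‖(⟨x 0, x 1⟩ : ℂ)‖ = ‖x‖ := by
    rw [EuclideanSpace.norm_eq, Complex.norm_eq_sqrt_sq_add_sq]
    simp [Fin.sum_univ_two]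
  ext i
  fin_cases i
  · simpa [unitVec, hn] using (Complex.norm_mul_cos_arg ⟨x 0, x 1⟩).symm
  · simpa [unitVec, hn] using (Complex.norm_mul_sin_arg ⟨x 0, x 1⟩).symm

theorem norm_sq_eq_unitVec_unitTangent (v : Plane) (φ : ℝ) :
    ‖v‖ ^ 2 = inner ℝ v (unitVec φ) ^ 2 + inner ℝ v (unitTangent φ) ^ 2 := by
  simp [EuclideanSpace.norm_sq_eq, unitVec, unitTangent, PiLp.inner_apply, Fin.sum_univ_two]
  linear_combination (-(v 0) ^ 2 - (v 1) ^ 2) * sin_sq_add_cos_sq φ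

theorem planeDiv_eq_unitVec_unitTangent (F : Plane → Plane) (x : Plane) (φ : ℝ) :
    planeDiv F x = inner ℝ (fderiv ℝ F x (unitVec φ)) (unitVec φ)
      + inner ℝ (fderiv ℝ F x (unitTangent φ)) (unitTangent φ) := by
  have hE : unitVec φ = cos φ • EuclideanSpace.single 0 1 + sin φ • EuclideanSpace.single 1 1 := by
    ext i; fin_cases i <;> simp [unitVec]
  have hT : unitTangent φ
      = -sin φ • EuclideanSpace.single 0 1 + cos φ • EuclideanSpace.single 1 1 := by
    ext i; fin_cases i <;> simp [unitTangent]
  rw [hE, hT]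
  simp [planeDiv, PiLp.inner_apply, Fin.sum_univ_two]
  set A := (fderiv ℝ F x (EuclideanSpace.single 0 1)).ofLp
  set B := (fderiv ℝ F x (EuclideanSpace.single 1 1)).ofLp
  linear_combination (-(A 0) - (B 1)) * sin_sq_add_cos_sq φ

theorem continuous_planeDiv {F : Plane → Plane} (hF : ContDiff ℝ 1 F) :
    Continuous (planeDiv F) := by
  have := hF.continuous_fderiv one_ne_zero
  unfold planeDiv
  fun_prop

/-- The flux of a vector field through the circle of radius `r`. -/
noncomputable def circleFlux (F : Plane → Plane) (r : ℝ) : ℝ :=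
  ∫ φ in 0..2 * π, inner ℝ (F (r • unitVec φ)) (r • unitVec φ)

/-- Radial differentiation yields only the normal half of the divergence, plus a term `F · unitVec`.
The angular derivative of `F · unitTangent` integrates to zero over a period; adding it cancels that
term and supplies the tangential half. -/
theorem hasDerivAt_circleFlux {F : Plane → Plane} (hF : ContDiff ℝ 1 F) (r : ℝ) :
    HasDerivAt (circleFlux F) (∫ φ in 0..2 * π, r * planeDiv F (r • unitVec φ)) r := by
  have hFc := hF.continuous
  have hDc := hF.continuous_fderiv one_ne_zero
  have hDF : ∀ x, HasFDerivAt F (fderiv ℝ F x) x := fun x =>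
    (hF.differentiable one_ne_zero x).hasFDerivAt
  have hE := continuous_unitVec
  have hT := continuous_unitTangent
  have h1 : ∀ s φ, HasDerivAt (fun t => inner ℝ (F (t • unitVec φ)) (t • unitVec φ))
      (inner ℝ (F (s • unitVec φ)) (unitVec φ)
        + inner ℝ (fderiv ℝ F (s • unitVec φ) (unitVec φ)) (s • unitVec φ)) s := fun s φ => by
    have hs : HasDerivAt (fun t : ℝ => t • unitVec φ) (unitVec φ) s := by
      simpa using (hasDerivAt_id s).smul_const (unitVec φ)
    exact ((hDF _).comp_hasDerivAt s hs).inner ℝ hs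
  have h2 : ∀ φ, HasDerivAt (fun φ => inner ℝ (F (r • unitVec φ)) (unitTangent φ))
      (inner ℝ (F (r • unitVec φ)) (-unitVec φ)
        + inner ℝ (fderiv ℝ F (r • unitVec φ) (r • unitTangent φ)) (unitTangent φ)) φ := fun φ =>
    ((hDF _).comp_hasDerivAt φ ((hasDerivAt_unitVec φ).const_smul r)).inner ℝ
      (hasDerivAt_unitTangent φ)
  have h3 := intervalIntegral.integral_eq_sub_of_hasDerivAt (a := 0) (b := 2 * π)
    (fun φ _ => h2 φ) (Continuous.intervalIntegrable (by fun_prop) _ _)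
  have h4 := hasDerivAt_intervalIntegral_of_continuous (a := 0) (b := 2 * π) h1
    (fun s => by fun_prop) (by unfold Function.uncurry; fun_prop) r
  have h5 : unitVec (2 * π) = unitVec 0 := by simp [unitVec]
  have h6 : unitTangent (2 * π) = unitTangent 0 := by simp [unitTangent]
  rw [h5, h6, sub_self] at h3
  refine h4.congr_deriv ((add_zero _).symm.trans ((congrArg _ h3.symm).trans ?_))
  rw [← intervalIntegral.integral_add]
  · refine intervalIntegral.integral_congr fun φ _ => ?_
    simp only [planeDiv_eq_unitVec_unitTangent _ _ φ, inner_neg_right, map_smul, inner_smul_left,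
      inner_smul_right, RCLike.conj_to_real]
    ring
  · exact Continuous.intervalIntegrable (by fun_prop) _ _
  · exact Continuous.intervalIntegrable (by fun_prop) _ _

theorem planeDiv_smul {h : Plane → ℝ} {F : Plane → Plane} {x : Plane}
    (hh : DifferentiableAt ℝ h x) (hF : DifferentiableAt ℝ F x) :
    planeDiv (fun y => h y • F y) x = h x * planeDiv F x + fderiv ℝ h x (F x) := by
  have hx : F x = F x 0 • EuclideanSpace.single 0 1 + F x 1 • EuclideanSpace.single 1 1 := by
    ext i; fin_cases i <;> simp
  rw [planeDiv, fderiv_fun_smul hh hF]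
  conv_rhs => rw [hx]
  simp [planeDiv, Fin.sum_univ_two]
  ring

/-! ### Energy flux of a single subsolution -/

/-- A nonnegative Lipschitz subsolution on the whole plane of an equation `div (a ∇f) = 0` whose
coefficient `a` takes values in `[l, 1]`. -/
structure IsPlanarSubsolution (l K : ℝ) (a f : Plane → ℝ) : Prop where
  contDiff : ContDiff ℝ 1 f
  contDiff_flux : ContDiff ℝ 1 fun x => a x • gradient f x
  div_nonneg : ∀ x, 0 ≤ planeDiv (fun x => a x • gradient f x) x
  nonneg : ∀ x, 0 ≤ f x
  le_coeff : ∀ x, l ≤ a x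
  coeff_le_one : ∀ x, a x ≤ 1
  norm_gradient_le : ∀ x, ‖gradient f x‖ ≤ K

/-- The flux of `f a ∇f` through the circle of radius `r`. -/
noncomputable def energyFlux (a f : Plane → ℝ) (r : ℝ) : ℝ :=
  circleFlux (fun x => f x • a x • gradient f x) r

/-- The derivative of `energyFlux`. -/
noncomputable def energyFluxDeriv (a f : Plane → ℝ) (r : ℝ) : ℝ :=
  ∫ φ in 0..2 * π, r * planeDiv (fun x => f x • a x • gradient f x) (r • unitVec φ)

theorem energyFlux_zero (a f : Plane → ℝ) : energyFlux a f 0 = 0 := by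
  simp [energyFlux, circleFlux]

theorem energyFlux_eq_zero {a f : Plane → ℝ} {r : ℝ} (h : ∀ φ, f (r • unitVec φ) = 0) :
    energyFlux a f r = 0 := by
  simp [energyFlux, circleFlux, h]

namespace IsPlanarSubsolution

variable {l K : ℝ} {a f : Plane → ℝ}

theorem contDiff_smul_flux (h : IsPlanarSubsolution l K a f)
    : ContDiff ℝ 1 fun x => f x • a x • gradient f x :=
  h.contDiff.smul h.contDiff_flux

theorem hasDerivAt_energyFlux (h : IsPlanarSubsolution l K a f) (r : ℝ) :
    HasDerivAt (energyFlux a f) (energyFluxDeriv a f r) r :=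
  hasDerivAt_circleFlux h.contDiff_smul_flux r

/-- The product rule gives `f div (a ∇f) + a |∇f|²`, and the first term is nonnegative. -/
theorem le_planeDiv (h : IsPlanarSubsolution l K a f) (x : Plane) :
    a x * ‖gradient f x‖ ^ 2 ≤ planeDiv (fun x => f x • a x • gradient f x) x := by
  rw [planeDiv_smul (h.contDiff.differentiable one_ne_zero x)
    (h.contDiff_flux.differentiable one_ne_zero x), map_smul, ← inner_gradient_left,
    real_inner_self_eq_norm_sq, smul_eq_mul]
  linarith [mul_nonneg (h.nonneg x) (h.div_nonneg x)]

theorem planeDiv_nonneg (h : IsPlanarSubsolution l K a f) (hl : 0 < l) (x : Plane) :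
    0 ≤ planeDiv (fun x => f x • a x • gradient f x) x :=
  (mul_nonneg (hl.le.trans (h.le_coeff x)) (sq_nonneg _)).trans (h.le_planeDiv x)

theorem continuous_planeDiv_circle (h : IsPlanarSubsolution l K a f) (r : ℝ) : Continuous fun φ =>
    planeDiv (fun x => f x • a x • gradient f x) (r • unitVec φ) :=
  (continuous_planeDiv h.contDiff_smul_flux).comp (continuous_unitVec.const_smul r)

theorem energyFluxDeriv_nonneg (h : IsPlanarSubsolution l K a f)
    (hl : 0 < l) {r : ℝ} (hr : 0 ≤ r) : 0 ≤ energyFluxDeriv a f r :=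
  intervalIntegral.integral_nonneg (by positivity) fun _ _ =>
    mul_nonneg hr (h.planeDiv_nonneg hl _)

theorem monotoneOn_energyFlux (h : IsPlanarSubsolution l K a f)
    (hl : 0 < l) : MonotoneOn (energyFlux a f) (Ici 0) := by
  refine monotoneOn_of_deriv_nonneg (convex_Ici 0)
    (fun x _ => (h.hasDerivAt_energyFlux x).continuousAt.continuousWithinAt)
    (fun x _ => (h.hasDerivAt_energyFlux x).differentiableAt.differentiableWithinAt) fun x hx => ?_
  rw [interior_Ici] at hx
  rw [(h.hasDerivAt_energyFlux x).deriv]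
  exact h.energyFluxDeriv_nonneg hl hx.le

theorem abs_le (h : IsPlanarSubsolution l K a f) (x : Plane) : |f x| ≤ |f 0| + K * ‖x‖ := by
  have h1 := Convex.norm_image_sub_le_of_norm_fderiv_le (𝕜 := ℝ) (C := K) (s := univ)
    (fun x _ => h.contDiff.differentiable one_ne_zero x)
    (fun x _ => by simpa [gradient] using h.norm_gradient_le x) convex_univ
    (mem_univ (0 : Plane)) (mem_univ x)
  rw [sub_zero, Real.norm_eq_abs] at h1
  linarith [abs_sub_abs_le_abs_sub (f x) (f 0)]

/-- One power of `r` comes from the linear growth of `f`, the other from the length of the circle.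
The condition `1 ≤ r` absorbs `|f 0|` into `|f 0| r`. -/
theorem energyFlux_le (h : IsPlanarSubsolution l K a f) (hl : 0 < l) {r : ℝ} (hr : 1 ≤ r) :
    energyFlux a f r ≤ ((|f 0| + K) * K * (2 * π)) * r ^ 2 := by
  have hK : 0 ≤ K := (norm_nonneg _).trans (h.norm_gradient_le 0)
  have hb : ∀ φ ∈ uIoc 0 (2 * π), ‖inner ℝ (f (r • unitVec φ) • a (r • unitVec φ) •
      gradient f (r • unitVec φ)) (r • unitVec φ)‖ ≤ (|f 0| + K) * K * r ^ 2 := fun φ _ => by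
    have hx : ‖r • unitVec φ‖ = r := by
      rw [norm_smul, norm_unitVec, mul_one, Real.norm_of_nonneg (by linarith)]
    set x := r • unitVec φ
    have ha0 : 0 ≤ a x := hl.le.trans (h.le_coeff x)
    refine (norm_inner_le_norm _ _).trans ?_
    rw [norm_smul, norm_smul, Real.norm_of_nonneg ha0, Real.norm_eq_abs, hx]
    have h1 := h.abs_le x
    rw [hx] at h1
    have h2 : |f x| ≤ (|f 0| + K) * r := by nlinarith [abs_nonneg (f 0)]
    have h3 : a x * ‖gradient f x‖ ≤ 1 * K :=
      mul_le_mul (h.coeff_le_one x) (h.norm_gradient_le x) (norm_nonneg _) zero_le_one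
    calc |f x| * (a x * ‖gradient f x‖) * r ≤ ((|f 0| + K) * r) * (1 * K) * r := by gcongr
      _ = _ := by ring
  have h1 := intervalIntegral.norm_integral_le_of_norm_le_const hb
  rw [sub_zero, abs_of_pos two_pi_pos] at h1
  refine (le_abs_self _).trans (h1.trans_eq ?_)
  ring

/-- A flux that is never positive vanishes for all `r ≥ 0` by monotonicity. Then so does its
derivative for `r > 0`, which forces `∇f = 0` away from the origin, where the factor `r` loses all
information. Continuity covers the origin, and `f` would be constant. -/
theorem exists_energyFlux_pos (h : IsPlanarSubsolution l K a f)
    (hl : 0 < l) {x y : Plane} (hxy : f x ≠ f y) :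
    ∃ r, 0 < r ∧ 0 < energyFlux a f r := by
  by_contra! hcon
  have hzero : ∀ r, 0 ≤ r → energyFlux a f r = 0 := fun r hr => by
    have h0 := h.monotoneOn_energyFlux hl self_mem_Ici hr hr
    rw [energyFlux_zero] at h0
    rcases hr.eq_or_lt with rfl | hr
    · exact energyFlux_zero a f
    · exact le_antisymm (hcon r hr) h0
  have hgrad : ∀ z : Plane, z ≠ 0 → gradient f z = 0 := fun z hz => by
    obtain ⟨φ, hφ⟩ := exists_eq_smul_unitVec z
    obtain ⟨ψ, hψ, hφψ⟩ := unitVec_periodic.exists_mem_Ico₀ two_pi_pos φ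
    have hr : 0 < ‖z‖ := norm_pos_iff.2 hz
    rw [hφψ] at hφ
    set r := ‖z‖
    have hd : energyFluxDeriv a f r = 0 := by
      refine (h.hasDerivAt_energyFlux r).unique
        ((hasDerivAt_const r (0 : ℝ)).congr_of_eventuallyEq ?_)
      filter_upwards [lt_mem_nhds hr] with s hs using hzero s hs.le
    by_contra hne
    have hpos : 0 < energyFluxDeriv a f r := by
      refine intervalIntegral.integral_pos two_pi_pos
        (continuous_const.mul (h.continuous_planeDiv_circle r)).continuousOn
        (fun _ _ => mul_nonneg hr.le (h.planeDiv_nonneg hl _))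
        ⟨ψ, Ico_subset_Icc_self hψ, mul_pos hr ?_⟩
      rw [← hφ]
      refine lt_of_lt_of_le ?_ (h.le_planeDiv z)
      have := hl.trans_le (h.le_coeff z)
      have := norm_pos_iff.2 hne
      positivity
    exact hpos.ne' hd
  have hfd : ∀ z, fderiv ℝ f z = 0 := by
    have hcl : closure {(0 : Plane)}ᶜ = univ := (dense_compl_singleton 0).closure_eq
    have hc : IsClosed {z | fderiv ℝ f z = 0} :=
      isClosed_eq (h.contDiff.continuous_fderiv one_ne_zero) continuous_const
    have hsub : closure {(0 : Plane)}ᶜ ⊆ {z | fderiv ℝ f z = 0} :=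
      closure_minimal (fun z hz => by simpa [gradient] using hgrad z hz) hc
    exact fun z => hsub (hcl ▸ mem_univ z)
  exact hxy (is_const_of_fderiv_eq_zero (h.contDiff.differentiable one_ne_zero) hfd x y)

/-- The growth of the energy flux is controlled by the angular measure of the support. -/
theorem energyFlux_le_energyFluxDeriv (h : IsPlanarSubsolution l K a f) (hl : 0 < l) {r φ₀ φ₁ : ℝ}
    (h0 : f (r • unitVec φ₀) = 0) (h1 : f (r • unitVec φ₁) ≠ 0) :
    0 < (∫ φ in 0..2 * π, supportIndicator (fun φ => f (r • unitVec φ)) φ) ∧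
    2 * (π * √l / ∫ φ in 0..2 * π, supportIndicator (fun φ => f (r • unitVec φ)) φ)
      * energyFlux a f r ≤ r * energyFluxDeriv a f r := by
  have hE := continuous_unitVec
  have hT := continuous_unitTangent
  have hfc := h.contDiff.continuous
  have hDc := h.contDiff.continuous_fderiv one_ne_zero
  have hXc := h.contDiff_smul_flux.continuous
  have hdc := h.continuous_planeDiv_circle r
  set g : ℝ → ℝ := fun φ => f (r • unitVec φ)
  set g' : ℝ → ℝ := fun φ => fderiv ℝ f (r • unitVec φ) (r • unitTangent φ) with hg'
  have hg : ∀ φ, HasDerivAt g (g' φ) φ := fun φ =>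
    (h.contDiff.differentiable one_ne_zero _).hasFDerivAt.comp_hasDerivAt φ
      ((hasDerivAt_unitVec φ).const_smul r)
  have hgc : Continuous g := by fun_prop
  have hg'c : Continuous g' := by fun_prop
  obtain ⟨hθ, hW⟩ := wirtinger_of_periodic two_pi_pos hg hg'c
    (fun φ => by simp only [g, unitVec_periodic φ])
    (fun φ => by simp only [g', unitVec_periodic φ, unitTangent_periodic φ]) h0 h1
  refine ⟨hθ, ?_⟩
  set θ := ∫ φ in 0..2 * π, supportIndicator g φ
  -- With this choice, `μ² ∫ g² ≤ l ∫ g'²` is exactly Wirtinger's inequality.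
  set μ := π * √l / θ with hμ
  have hμ2 : μ ^ 2 = l * (π / θ) ^ 2 := by
    rw [hμ, div_pow, mul_pow, sq_sqrt hl.le]
    ring
  have hi1 : IntervalIntegrable (fun φ => μ ^ 2 * g φ ^ 2) volume 0 (2 * π) :=
    Continuous.intervalIntegrable (by fun_prop) _ _
  have hi2 : IntervalIntegrable (fun φ => l * g' φ ^ 2) volume 0 (2 * π) :=
    Continuous.intervalIntegrable (by fun_prop) _ _
  have hi3 : IntervalIntegrable (fun φ => r * (r * planeDiv (fun x => f x • a x • gradient f x)
      (r • unitVec φ))) volume 0 (2 * π) :=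
    Continuous.intervalIntegrable (by fun_prop) _ _
  have hi4 : IntervalIntegrable (fun φ => 2 * μ * inner ℝ (f (r • unitVec φ) • a (r • unitVec φ) •
      gradient f (r • unitVec φ)) (r • unitVec φ)) volume 0 (2 * π) :=
    (continuous_const.mul ((hXc.comp (hE.const_smul r)).inner
      (hE.const_smul r))).intervalIntegrable _ _
  -- Pointwise, `A (μ g - r n)² ≥ 0` splits the flux density. The upper bound `A ≤ 1` is spent on
  -- `μ² g²`, the lower bound `l ≤ A` on the tangential energy `(r t)² = g'²`. This split is what
  -- produces `√l` instead of `l`.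
  have hmono := intervalIntegral.integral_mono_on two_pi_pos.le hi4 ((hi1.sub hi2).add hi3)
    fun φ _ => by
      have hd := h.le_planeDiv (r • unitVec φ)
      have hg'φ : g' φ = r * inner ℝ (gradient f (r • unitVec φ)) (unitTangent φ) := by
        simp only [hg', map_smul, inner_gradient_left, smul_eq_mul]
      have hal := h.le_coeff (r • unitVec φ)
      have ha1 := h.coeff_le_one (r • unitVec φ)
      rw [norm_sq_eq_unitVec_unitTangent _ φ] at hd
      simp only [hg'φ, inner_smul_left, inner_smul_right, RCLike.conj_to_real]
      set n := inner ℝ (gradient f (r • unitVec φ)) (unitVec φ)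
      set t := inner ℝ (gradient f (r • unitVec φ)) (unitTangent φ)
      set A := a (r • unitVec φ)
      set D := planeDiv (fun x => f x • a x • gradient f x) (r • unitVec φ)
      change 2 * μ * (r * (g φ * (A * n))) ≤ μ ^ 2 * g φ ^ 2 - l * (r * t) ^ 2 + r * (r * D)
      have e1 : r ^ 2 * (A * (n ^ 2 + t ^ 2)) ≤ r ^ 2 * D :=
        mul_le_mul_of_nonneg_left hd (sq_nonneg r)
      have e2 : 0 ≤ A * (μ * g φ - r * n) ^ 2 :=
        mul_nonneg (hl.le.trans hal) (sq_nonneg _)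
      have e3 : A * (μ * g φ) ^ 2 ≤ 1 * (μ * g φ) ^ 2 :=
        mul_le_mul_of_nonneg_right ha1 (sq_nonneg _)
      have e4 : l * (r * t) ^ 2 ≤ A * (r * t) ^ 2 :=
        mul_le_mul_of_nonneg_right hal (sq_nonneg _)
      linarith
  rw [intervalIntegral.integral_add (hi1.sub hi2) hi3, intervalIntegral.integral_sub hi1 hi2]
    at hmono
  simp only [intervalIntegral.integral_const_mul r, intervalIntegral.integral_const_mul l,
    intervalIntegral.integral_const_mul (μ ^ 2), intervalIntegral.integral_const_mul (2 * μ)]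
    at hmono
  have hW' := mul_le_mul_of_nonneg_left hW hl.le
  rw [← mul_assoc, ← hμ2] at hW'
  have e : energyFluxDeriv a f r = r * ∫ φ in 0..2 * π,
      planeDiv (fun x => f x • a x • gradient f x) (r • unitVec φ) :=
    intervalIntegral.integral_const_mul _ _
  rw [e]
  change 2 * μ * energyFlux a f r ≤ _ at hmono
  linarith

end IsPlanarSubsolution

/-! ### Disjointly supported families -/

theorem sum_integral_supportIndicator_le {ι : Type*} [Fintype ι] {g : ι → ℝ → ℝ} {a b : ℝ}
    (hab : a ≤ b) (hg : ∀ i, Continuous (g i))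
    (hdisj : ∀ i j, i ≠ j → ∀ x, g i x = 0 ∨ g j x = 0) :
    ∑ i, ∫ x in a..b, supportIndicator (g i) x ≤ b - a := by
  rw [← intervalIntegral.integral_finsetSum
    fun i _ => intervalIntegrable_supportIndicator (hg i) a b]
  have h_int : IntervalIntegrable (fun x => ∑ i, supportIndicator (g i) x) volume a b := by
    simpa only [Finset.sum_fn] using IntervalIntegrable.sum Finset.univ
      fun i _ => intervalIntegrable_supportIndicator (hg i) a b
  have hone : b - a = ∫ _ in a..b, (1 : ℝ) := by simp
  rw [hone]
  refine intervalIntegral.integral_mono_on hab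
    h_int intervalIntegrable_const fun x _ => ?_
  by_cases hx : ∃ i, g i x ≠ 0
  · obtain ⟨i, hi⟩ := hx
    rw [Finset.sum_eq_single i (fun j _ hj => supportIndicator_of_eq
      ((hdisj i j hj.symm x).resolve_left hi)) (by simp)]
    exact supportIndicator_le_one _ _
  · push Not at hx
    simp [supportIndicator_of_eq (hx _)]

section Family

variable {ι : Type*} [Fintype ι] [Nontrivial ι] {l K : ℝ} {a f : ι → Plane → ℝ}

theorem sum_energyFluxDeriv_div_ge (hl : 0 < l) (h : ∀ i, IsPlanarSubsolution l K (a i) (f i))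
    (hdisj : ∀ i j, i ≠ j → ∀ x, f i x = 0 ∨ f j x = 0) {r : ℝ} (hr : 0 < r)
    (hpos : ∀ i, 0 < energyFlux (a i) (f i) r) :
    (Fintype.card ι : ℝ) ^ 2 * √l / r
      ≤ ∑ i, energyFluxDeriv (a i) (f i) r / energyFlux (a i) (f i) r := by
  have hne : ∀ i, ∃ φ, f i (r • unitVec φ) ≠ 0 := fun i => by
    by_contra! hcon
    exact (hpos i).ne' (energyFlux_eq_zero hcon)
  -- Wirtinger's inequality needs a zero on the circle. A second member of the family provides it,
  -- at a point where that member is nonzero.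
  have hzero : ∀ i, ∃ φ, f i (r • unitVec φ) = 0 := fun i => by
    obtain ⟨j, hj⟩ := exists_ne i
    obtain ⟨φ, hφ⟩ := hne j
    exact ⟨φ, (hdisj j i hj _).resolve_left hφ⟩
  choose φ₁ h1 using hne
  choose φ₀ h0 using hzero
  set θ : ι → ℝ := fun i => ∫ φ in 0..2 * π, supportIndicator (fun φ => f i (r • unitVec φ)) φ
  have key : ∀ i, 0 < θ i ∧ 2 * (π * √l / θ i) * energyFlux (a i) (f i) r
      ≤ r * energyFluxDeriv (a i) (f i) r := fun i =>
    (h i).energyFlux_le_energyFluxDeriv hl (h0 i) (h1 i)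
  have hsum : ∑ i, θ i ≤ 2 * π := by
    simpa using sum_integral_supportIndicator_le two_pi_pos.le
      (g := fun i φ => f i (r • unitVec φ))
      (fun i => (h i).contDiff.continuous.comp (continuous_unitVec.const_smul r))
      fun i j hij φ => hdisj i j hij _
  have hsumpos : 0 < ∑ i, θ i := Finset.sum_pos (fun i _ => (key i).1) Finset.univ_nonempty
  have hcs := Finset.sq_sum_div_le_sum_sq_div Finset.univ (fun _ : ι => (1 : ℝ)) (g := θ)
    fun i _ => (key i).1
  simp only [Finset.sum_const, Finset.card_univ, nsmul_eq_mul, mul_one, one_pow] at hcs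
  have hcs' : (Fintype.card ι : ℝ) ^ 2 / (2 * π) ≤ ∑ i, 1 / θ i :=
    (div_le_div_of_nonneg_left (sq_nonneg _) hsumpos hsum).trans hcs
  calc (Fintype.card ι : ℝ) ^ 2 * √l / r
      = (2 * π * √l / r) * ((Fintype.card ι : ℝ) ^ 2 / (2 * π)) := by
        field_simp
    _ ≤ (2 * π * √l / r) * ∑ i, 1 / θ i := by gcongr
    _ = ∑ i, (2 * π * √l / r) * (1 / θ i) := Finset.mul_sum _ _ _
    _ ≤ _ := Finset.sum_le_sum fun i _ => by
        have h2 := (key i).2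
        have hθ := (key i).1
        have e : 2 * π * √l / r * (1 / θ i) = 2 * (π * √l / θ i) / r := by
          field_simp
        rw [e, div_le_div_iff₀ hr (hpos i)]
        linarith

/-- Disjointly supported Lipschitz subsolutions on the plane: a bound on their number in terms of
the ellipticity constant. -/
theorem card_mul_sqrt_le_two (hl : 0 < l) (h : ∀ i, IsPlanarSubsolution l K (a i) (f i))
    (hdisj : ∀ i j, i ≠ j → ∀ x, f i x = 0 ∨ f j x = 0) (hne : ∀ i, ∃ x, f i x ≠ 0) :
    (Fintype.card ι : ℝ) * √l ≤ 2 := by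
  have hex : ∀ i, ∃ r, 0 < r ∧ 0 < energyFlux (a i) (f i) r := fun i => by
    obtain ⟨j, hj⟩ := exists_ne i
    obtain ⟨x, hx⟩ := hne i
    obtain ⟨y, hy⟩ := hne j
    exact (h i).exists_energyFlux_pos hl (x := x) (y := y)
      (by rwa [(hdisj j i hj y).resolve_left hy])
  choose ρ hρ hρJ using hex
  obtain ⟨R, hR⟩ : ∃ R : ℝ, 1 ≤ R ∧ ∀ i, ρ i ≤ R := by
    obtain ⟨R, hR⟩ := (Set.finite_range ρ).bddAbove
    exact ⟨max 1 R, le_max_left _ _, fun i => (hR (mem_range_self i)).trans (le_max_right _ _)⟩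
  obtain ⟨hR1, hρR⟩ := hR
  have hpos : ∀ r, R ≤ r → ∀ i, 0 < energyFlux (a i) (f i) r := fun r hr i =>
    (hρJ i).trans_le ((h i).monotoneOn_energyFlux hl (hρ i).le
      ((hρ i).le.trans ((hρR i).trans hr)) ((hρR i).trans hr))
  set N : ℝ := (Fintype.card ι : ℝ) ^ 2 * √l with hN
  have hderiv : ∀ r, R ≤ r → HasDerivAt
      (fun r => ∑ i, log (energyFlux (a i) (f i) r) - N * log r)
      (∑ i, energyFluxDeriv (a i) (f i) r / energyFlux (a i) (f i) r - N * r⁻¹) r :=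
    fun r hr => (HasDerivAt.fun_sum fun i _ =>
      ((h i).hasDerivAt_energyFlux r).log (hpos r hr i).ne').sub
      ((hasDerivAt_log (by linarith)).const_mul N)
  -- Integrated form of the differential inequality: the product of the fluxes divided by `r ^ N` is
  -- nondecreasing.
  have hmono : MonotoneOn (fun r => ∑ i, log (energyFlux (a i) (f i) r) - N * log r) (Ici R) := by
    refine monotoneOn_of_deriv_nonneg (convex_Ici R)
      (fun r hr => (hderiv r hr).continuousAt.continuousWithinAt)
      (fun r hr => (hderiv r (interior_subset hr)).differentiableAt.differentiableWithinAt)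
      fun r hr => ?_
    have hr' : R ≤ r := interior_subset hr
    rw [(hderiv r hr').deriv, ← div_eq_mul_inv, sub_nonneg]
    exact sum_energyFluxDeriv_div_ge hl h hdisj (by linarith) (hpos r hr')
  set B : ℝ := ∑ i, log ((|f i 0| + K) * K * (2 * π))
  set b : ℝ := ∑ i, log (energyFlux (a i) (f i) R) - N * log R with hb
  -- The lower growth rate `N` meets the upper rate of two per member; letting `r → ∞` then compares
  -- the exponents.
  have hlog : ∀ r, R ≤ r → (N - 2 * Fintype.card ι) * log r ≤ B - b := fun r hr => by
    have h1 : b ≤ _ := hmono self_mem_Ici hr hr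
    have h2 : ∑ i, log (energyFlux (a i) (f i) r)
        ≤ ∑ i, (log ((|f i 0| + K) * K * (2 * π)) + 2 * log r) :=
      Finset.sum_le_sum fun i _ => by
        have hle := (h i).energyFlux_le hl (hR1.trans hr)
        have hC : 0 < (|f i 0| + K) * K * (2 * π) :=
          pos_of_mul_pos_left ((hpos r hr i).trans_le hle) (sq_nonneg r)
        refine (log_le_log (hpos r hr i) hle).trans_eq ?_
        rw [log_mul hC.ne' (by nlinarith), log_pow]
        norm_num
    rw [Finset.sum_add_distrib, Finset.sum_const, Finset.card_univ, nsmul_eq_mul] at h2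
    simp only at h1
    linarith
  have hN2 : N ≤ 2 * Fintype.card ι := by
    by_contra! hcon
    obtain ⟨r, hr1, hr2⟩ := ((tendsto_log_atTop.const_mul_atTop
      (sub_pos.2 hcon)).eventually_gt_atTop (B - b)).and (eventually_ge_atTop R) |>.exists
    exact absurd (hlog r hr2) (not_le.2 hr1)
  have hcard : (0 : ℝ) < Fintype.card ι := by exact_mod_cast Fintype.card_pos
  rw [hN] at hN2
  refine le_of_mul_le_mul_left ?_ hcard
  linarith

end Family

/-! ### Truncated minimal graphs as subsolutions -/

/-- A convex `C²` function vanishing exactly on `(-∞, 0]`, with slope at most one. -/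
noncomputable def smoothPosPart (t : ℝ) : ℝ := ∫ s in 0..t, smoothTransition s

theorem hasDerivAt_smoothPosPart (t : ℝ) : HasDerivAt smoothPosPart (smoothTransition t) t :=
  smoothTransition.continuous.integral_hasStrictDerivAt 0 t |>.hasDerivAt

theorem smoothPosPart_of_nonpos {t : ℝ} (ht : t ≤ 0) : smoothPosPart t = 0 := by
  rw [smoothPosPart, intervalIntegral.integral_symm, neg_eq_zero]
  refine (intervalIntegral.integral_congr fun s hs => ?_).trans intervalIntegral.integral_zero
  rw [uIcc_of_le ht] at hs
  exact smoothTransition.zero_of_nonpos hs.2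

theorem smoothPosPart_pos {t : ℝ} (ht : 0 < t) : 0 < smoothPosPart t :=
  intervalIntegral.integral_pos ht smoothTransition.continuous.continuousOn
    (fun s _ => smoothTransition.nonneg s)
    ⟨t, right_mem_Icc.2 ht.le, smoothTransition.pos_of_pos ht⟩

theorem smoothPosPart_nonneg (t : ℝ) : 0 ≤ smoothPosPart t := by
  rcases le_or_gt t 0 with ht | ht
  · exact (smoothPosPart_of_nonpos ht).ge
  · exact (smoothPosPart_pos ht).le

theorem contDiff_smoothPosPart : ContDiff ℝ 1 smoothPosPart := by
  have h : deriv smoothPosPart = smoothTransition :=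
    funext fun t => (hasDerivAt_smoothPosPart t).deriv
  rw [contDiff_one_iff_deriv, h]
  exact ⟨fun t => (hasDerivAt_smoothPosPart t).differentiableAt, smoothTransition.continuous⟩

open Classical in
/-- The coefficient `(1 + |∇u|²)^(-1/2)` on `Ω`, extended by one. -/
noncomputable def minimalCoeff (Ω : Set Plane) (u : Plane → ℝ) : Plane → ℝ :=
  Ω.piecewise (fun y => (√(1 + ‖gradient u y‖ ^ 2))⁻¹) 1

theorem minimalCoeff_of_mem {Ω : Set Plane} (u : Plane → ℝ) {x : Plane} (hx : x ∈ Ω) :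
    minimalCoeff Ω u x = (√(1 + ‖gradient u x‖ ^ 2))⁻¹ := by
  simp [minimalCoeff, hx]

theorem minimalCoeff_of_notMem {Ω : Set Plane} (u : Plane → ℝ) {x : Plane} (hx : x ∉ Ω) :
    minimalCoeff Ω u x = 1 := by
  simp [minimalCoeff, hx]

/-- A smoothed version of `max (u - ε) 0` on `Ω`, extended by zero. -/
noncomputable def truncation (Ω : Set Plane) (u : Plane → ℝ) (ε : ℝ) : Plane → ℝ :=
  Ω.indicator fun x => smoothPosPart (u x - ε)

theorem planeDiv_congr {F G : Plane → Plane} {x : Plane} (h : F =ᶠ[𝓝 x] G) :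
    planeDiv F x = planeDiv G x := by
  rw [planeDiv, planeDiv, h.fderiv_eq]

theorem ContDiffAt.gradient {u : Plane → ℝ} {x : Plane} (h : ContDiffAt ℝ 2 u x) :
    ContDiffAt ℝ 1 (gradient u) x :=
  (InnerProductSpace.toDual ℝ Plane).symm.toContinuousLinearEquiv.contDiff.contDiffAt.comp x
    (h.fderiv_right (m := 1) (by norm_num))

namespace IsSupportedMinimalGraph

variable {Ω : Set Plane} {u : Plane → ℝ}

theorem contDiffAt (h : IsSupportedMinimalGraph Ω u)
    {x : Plane} (hx : x ∈ Ω) : ContDiffAt ℝ 2 u x :=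
  h.contDiffOn.contDiffAt (h.isOpen.mem_nhds hx)

/-- The set `closure Ω ∩ {u ≥ ε}` is closed and, since `u = 0` on the frontier, lies in `Ω`. The
truncation therefore vanishes near the boundary, and no regularity of `u` or of `Ω` is needed there.
-/
theorem truncation_eventuallyEq_zero (h : IsSupportedMinimalGraph Ω u)
    {ε : ℝ} (hε : 0 < ε) {x : Plane} (hx : x ∉ Ω) :
    truncation Ω u ε =ᶠ[𝓝 x] fun _ => 0 := by
  have hclosed : IsClosed (closure Ω ∩ u ⁻¹' Ici ε) :=
    h.continuousOn_closure.preimage_isClosed_of_isClosed isClosed_closure isClosed_Ici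
  have hxK : x ∉ closure Ω ∩ u ⁻¹' Ici ε := fun hxK => by
    have := h.boundary_eq_zero x (h.isOpen.frontier_eq ▸ ⟨hxK.1, hx⟩)
    have := hxK.2
    simp only [mem_preimage, mem_Ici] at this
    linarith
  filter_upwards [hclosed.isOpen_compl.mem_nhds hxK] with y hy
  by_cases hyΩ : y ∈ Ω
  · rw [truncation, indicator_of_mem hyΩ]
    refine smoothPosPart_of_nonpos ?_
    by_contra! hcon
    exact hy ⟨subset_closure hyΩ, by simp only [mem_preimage, mem_Ici]; linarith⟩
  · exact indicator_of_notMem hyΩ _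

theorem truncation_eventuallyEq (h : IsSupportedMinimalGraph Ω u) (ε : ℝ) {x : Plane} (hx : x ∈ Ω) :
    truncation Ω u ε =ᶠ[𝓝 x] fun y => smoothPosPart (u y - ε) := by
  filter_upwards [h.isOpen.mem_nhds hx] with y hy using indicator_of_mem hy _

theorem gradient_truncation (h : IsSupportedMinimalGraph Ω u) (ε : ℝ) {x : Plane} (hx : x ∈ Ω) :
    gradient (truncation Ω u ε) x = smoothTransition (u x - ε) • gradient u x := by
  have hu := ((h.contDiffAt hx).differentiableAt two_ne_zero).hasFDerivAt.sub_const ε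
  have hd := (hasDerivAt_smoothPosPart (u x - ε)).comp_hasFDerivAt x hu
  rw [(h.truncation_eventuallyEq ε hx).gradient_eq]
  have hd' : fderiv ℝ (fun y => smoothPosPart (u y - ε)) x
      = smoothTransition (u x - ε) • fderiv ℝ u x := hd.fderiv
  simp only [gradient, hd', map_smul]

theorem flux_eventuallyEq (h : IsSupportedMinimalGraph Ω u) (ε : ℝ) {x : Plane} (hx : x ∈ Ω) :
    (fun y => minimalCoeff Ω u y • gradient (truncation Ω u ε) y) =ᶠ[𝓝 x]
      fun y => smoothTransition (u y - ε) • (√(1 + ‖gradient u y‖ ^ 2))⁻¹ • gradient u y := by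
  filter_upwards [h.isOpen.mem_nhds hx] with y hy
  rw [h.gradient_truncation ε hy, minimalCoeff_of_mem u hy, smul_comm]

theorem flux_eventuallyEq_zero (h : IsSupportedMinimalGraph Ω u)
    {ε : ℝ} (hε : 0 < ε) {x : Plane} (hx : x ∉ Ω) :
    (fun y => minimalCoeff Ω u y • gradient (truncation Ω u ε) y) =ᶠ[𝓝 x] fun _ => 0 := by
  filter_upwards [(h.truncation_eventuallyEq_zero hε hx).gradient] with y hy
  rw [hy, gradient_fun_const, smul_zero]

theorem contDiffAt_normalized_gradient (h : IsSupportedMinimalGraph Ω u) {x : Plane} (hx : x ∈ Ω) :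
    ContDiffAt ℝ 1 (fun y => (√(1 + ‖gradient u y‖ ^ 2))⁻¹ • gradient u y) x := by
  have hg := (h.contDiffAt hx).gradient
  have hp : 0 < 1 + ‖gradient u x‖ ^ 2 := by positivity
  exact (((contDiffAt_const.add (hg.norm_sq ℝ)).sqrt hp.ne').inv (sqrt_pos.2 hp).ne').smul hg

theorem contDiffAt_smoothTransition (h : IsSupportedMinimalGraph Ω u)
    (ε : ℝ) {x : Plane} (hx : x ∈ Ω) :
    ContDiffAt ℝ 1 (fun y => smoothTransition (u y - ε)) x :=
  (smoothTransition.contDiff (n := 1)).contDiffAt.comp x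
    (((h.contDiffAt hx).of_le (by norm_num)).sub contDiffAt_const)

/-- The normalized gradient is divergence free, so only the derivative of the cutoff remains: a
nonnegative multiple of `|∇u|²`, because `smoothTransition` is monotone. -/
theorem planeDiv_flux_nonneg (h : IsSupportedMinimalGraph Ω u) (ε : ℝ) {x : Plane} (hx : x ∈ Ω) :
    0 ≤ planeDiv (fun y => minimalCoeff Ω u y • gradient (truncation Ω u ε) y) x := by
  rw [planeDiv_congr (h.flux_eventuallyEq ε hx),
    planeDiv_smul ((h.contDiffAt_smoothTransition ε hx).differentiableAt one_ne_zero)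
      ((h.contDiffAt_normalized_gradient hx).differentiableAt one_ne_zero),
    h.div_eq_zero x hx, mul_zero, zero_add]
  have hu := ((h.contDiffAt hx).differentiableAt two_ne_zero).hasFDerivAt.sub_const ε
  have ht : HasDerivAt smoothTransition (deriv smoothTransition (u x - ε)) (u x - ε) :=
    ((smoothTransition.contDiff (n := 1)).differentiable one_ne_zero _).hasDerivAt
  have hcomp := ht.comp_hasFDerivAt x hu
  have hd : fderiv ℝ (fun y => smoothTransition (u y - ε)) x
      = deriv smoothTransition (u x - ε) • fderiv ℝ u x := hcomp.fderiv
  rw [hd, smul_apply, map_smul, ← inner_gradient_left, real_inner_self_eq_norm_sq]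
  have := smoothTransition.monotone.deriv_nonneg (x := u x - ε)
  simp only [smul_eq_mul]
  positivity

/-- The truncations of a minimal graph with bounded gradient are subsolutions on the plane. -/
theorem isPlanarSubsolution_truncation (h : IsSupportedMinimalGraph Ω u)
    {c ε : ℝ} (hc : 0 ≤ c) (hε : 0 < ε)
    (hgrad : ∀ x ∈ Ω, ‖gradient u x‖ ≤ c) :
    IsPlanarSubsolution (√(1 + c ^ 2))⁻¹ c (minimalCoeff Ω u) (truncation Ω u ε) where
  contDiff := contDiff_iff_contDiffAt.2 fun x => by
    by_cases hx : x ∈ Ω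
    · exact (contDiff_smoothPosPart.contDiffAt.comp x
        (((h.contDiffAt hx).of_le (by norm_num)).sub contDiffAt_const)).congr_of_eventuallyEq
        (h.truncation_eventuallyEq ε hx)
    · exact contDiffAt_const.congr_of_eventuallyEq (h.truncation_eventuallyEq_zero hε hx)
  contDiff_flux := contDiff_iff_contDiffAt.2 fun x => by
    by_cases hx : x ∈ Ω
    · exact ((h.contDiffAt_smoothTransition ε hx).smul
        (h.contDiffAt_normalized_gradient hx)).congr_of_eventuallyEq (h.flux_eventuallyEq ε hx)
    · exact contDiffAt_const.congr_of_eventuallyEq (h.flux_eventuallyEq_zero hε hx)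
  div_nonneg x := by
    by_cases hx : x ∈ Ω
    · exact h.planeDiv_flux_nonneg ε hx
    · rw [planeDiv_congr (h.flux_eventuallyEq_zero hε hx)]
      simp [planeDiv]
  nonneg x := indicator_nonneg (fun _ _ => smoothPosPart_nonneg _) x
  le_coeff x := by
    by_cases hx : x ∈ Ω
    · rw [minimalCoeff_of_mem u hx]
      have := hgrad x hx
      gcongr
    · rw [minimalCoeff_of_notMem u hx]
      exact inv_le_one_of_one_le₀ (one_le_sqrt.2 (by nlinarith))
  coeff_le_one x := by
    by_cases hx : x ∈ Ω
    · rw [minimalCoeff_of_mem u hx]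
      exact inv_le_one_of_one_le₀ (one_le_sqrt.2 (by nlinarith [sq_nonneg ‖gradient u x‖]))
    · exact (minimalCoeff_of_notMem u hx).le
  norm_gradient_le x := by
    by_cases hx : x ∈ Ω
    · rw [h.gradient_truncation ε hx, norm_smul,
        Real.norm_of_nonneg (smoothTransition.nonneg _)]
      exact (mul_le_of_le_one_left (norm_nonneg _) (smoothTransition.le_one _)).trans (hgrad x hx)
    · rw [(h.truncation_eventuallyEq_zero hε hx).gradient_eq, gradient_fun_const, norm_zero]
      exact hc

end IsSupportedMinimalGraph

/-! ### The bound on the number of graphs -/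

theorem theorem3p1 (k : ℕ) (Ω : Fin k → Set Plane) (u : Fin k → Plane → ℝ) (c : ℝ)
    (hgraph : ∀ i, IsSupportedMinimalGraph (Ω i) (u i))
    (hnontrivial : ∀ i, ∃ x ∈ Ω i, u i x ≠ 0)
    (hdisjoint : ∀ i j, i ≠ j → Disjoint (Ω i) (Ω j))
    (hgrad : ∀ i, ∀ x ∈ Ω i, ‖gradient (u i) x‖ ≤ c) :
    (k : ℝ) ≤ 2 * Real.sqrt (1 + c ^ 2) := by
  have hs : 1 ≤ √(1 + c ^ 2) := one_le_sqrt.2 (by nlinarith)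
  -- The growth argument needs two graphs; for fewer the bound is trivial.
  rcases lt_or_ge k 2 with hk | hk
  · have : (k : ℝ) < 2 := by exact_mod_cast hk
    linarith
  have : Nontrivial (Fin k) := Fin.nontrivial_iff_two_le.2 hk
  choose p hpΩ hp using hnontrivial
  have hc : 0 ≤ c := (norm_nonneg _).trans (hgrad ⟨0, by omega⟩ _ (hpΩ _))
  have hup : ∀ i, 0 < u i (p i) := fun i =>
    lt_of_le_of_ne ((hgraph i).nonneg _ (hpΩ i)) (hp i).symm
  have hl : 0 < (√(1 + c ^ 2))⁻¹ := by positivity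
  -- The level `u i (p i) / 2` keeps the truncation nonzero at `p i`.
  have key := card_mul_sqrt_le_two hl
    (fun i => (hgraph i).isPlanarSubsolution_truncation hc (half_pos (hup i)) (hgrad i))
    (fun i j hij x => by
      by_cases hx : x ∈ Ω i
      · exact .inr (indicator_of_notMem (disjoint_left.1 (hdisjoint i j hij) hx) _)
      · exact .inl (indicator_of_notMem hx _))
    (fun i => ⟨p i, by
      rw [truncation, indicator_of_mem (hpΩ i)]
      exact (smoothPosPart_pos (by linarith [hup i])).ne'⟩)
  rw [Fintype.card_fin] at key
  -- At this point `k ≤ 2 (1 + c²)^(1/4)` is known, which is stronger than the claim; `l ≤ √l` for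
  -- `l ≤ 1` weakens it.
  have hle : (√(1 + c ^ 2))⁻¹ ≤ √(√(1 + c ^ 2))⁻¹ := by
    refine le_sqrt_of_sq_le ?_
    rw [sq]
    exact mul_le_of_le_one_left hl.le (inv_le_one_of_one_le₀ hs)
  have h2 : (k : ℝ) * (√(1 + c ^ 2))⁻¹ ≤ 2 :=
    (mul_le_mul_of_nonneg_left hle k.cast_nonneg).trans key
  rwa [← div_eq_mul_inv, div_le_iff₀ (by linarith)] at h2
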